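/- Let $n\le 3$ be a natural number and $[n]=\{1,\dots,n\}$. We consider vectors $\pi=(\pi_S)$ of real numbers indexed by the nonempty subsets $S\subseteq[n]$, i.e. $\pi\in\mathbb{R}^{2^n-1}$. All families below are finite families of nonempty subsets of $[n]$, in which a subset may occur more than once. An object is a compact set $T\subset\mathbb{R}^n_{+}=[0,\infty)^n$; $T_S$ is its orthogonal projection onto the span of the coordinate axes in $S$, and $|T_S|$ is the $|S|$-dimensional volume of $T_S$. Let $$\Psi_n=\{\pi\in\mathbb{R}^{2^n-1} : \text{there is an object } T \text{ with } \log|T_S|=\pi_S \text{ for all nonempty } S\subseteq[n]\}$$ (with $\log 0=-\infty$, so $|T_S|>0$ for all $S$). A family $\mathcal{A}$ of subsets of $S$ is a $k$-cover of $S$ if each element of $S$ lies in exactly $k$ members of $\mathcal{A}$. The BT inequalities are the inequalities $k\pi_S\le\sum_{A\in\mathcal{A}}\pi_A$, for $\emptyset\neq S\subseteq[n]$, $k \in \mathbb{N}$ and $\mathcal{A}$ a $k$-cover of $S$; $\mathcal{BT}_n$ is the set of all $\pi\in\mathbb{R}^{2^n-1}$ that satisfy all of them. A family $\mathcal{A}=\{A_i\}_{i=1}^k$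 covers a family $\mathcal{B}=\{B_j\}_{j=1}^m$ if every $e\in[n]$ lies in equally many of the $A_i$ as of the $B_j$, and there is a bijection $f$ from $\{(i,t): t\in A_i\}$ to $\{(j,s): s\in B_j\}$ such that $f(i,t)=(j,s)$ implies $s=t$ and $A_i\subseteq B_j$. The NC inequalities are the inequalities $\sum_{j}\pi_{B_j}\le\sum_{i}\pi_{A_i}$, for $\mathcal{A}$ covering $\mathcal{B}$; $\mathcal{NC}_n$ is the set of all $\pi\in\mathbb{R}^{2^n-1}$ that satisfy all of them. Then: 1. $\mathcal{BT}_n=\mathcal{NC}_n=\Psi_n$. 2. Every NC inequality is a nonnegative combination of BT inequalities: its coefficient vector $\sum_i \mathbf{e}_{A_i}-\sum_j \mathbf{e}_{B_j}\in\mathbb{R}^{2^n-1}$ is a finite linear combination, with nonnegative real coefficients, of coefficient vectors $\sum_{A\in\mathcal{A}}\mathbf{e}_A-k\,\mathbf{e}_S$ of BT inequalities, where $\mathbf{e}_S$ denotes the standard basis vector indexed by $S$. 3. $\Psi_n$ is convex. -/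

import Mathlib

/-- The index set of the coordinates of a log-projection vector: the nonempty subsets of
`[n]`. -/
abbrev NESubset (n : ℕ) : Type := {S : Finset (Fin n) // S.Nonempty}

/-- An object: a compact (hence bounded) subset of the closed nonnegative orthant. -/
def IsObject {n : ℕ} (T : Set (Fin n → ℝ)) : Prop :=
  IsCompact T ∧ ∀ x ∈ T, ∀ i, 0 ≤ x i

/-- The projection `T_S` of `T` onto the coordinate subspace spanned by the axes in `S`, this
subspace being identified with `ℝ^S`. -/
def coordProj {n : ℕ} (S : Finset (Fin n)) (T : Set (Fin n → ℝ)) : Set (S → ℝ) :=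
  (fun (x : Fin n → ℝ) (i : S) => x i) '' T

/-- The log-projection vector of `T`, whose entry at `S` is the logarithm of the `|S|`-dimensional
volume of `T_S`; the logarithm takes values in `[-∞, ∞]`, with `log 0 = -∞`. -/
noncomputable def logProjVector {n : ℕ} (T : Set (Fin n → ℝ)) (S : NESubset n) : EReal :=
  ENNReal.log (MeasureTheory.volume (coordProj S.1 T))

/-- The constructible region `Ψ_n`: all real vectors that are the log-projection vector of some
object. -/
def constructibleRegion (n : ℕ) : Set (NESubset n → ℝ) :=
  {π | ∃ T : Set (Fin n → ℝ), IsObject T ∧ ∀ S, logProjVector T S = ((π S : ℝ) : EReal)}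

/-- The family `A` (a subset may occur several times) is a `k`-cover of `S`: its members are
subsets of `S`, and each element of `S` lies in exactly `k` of them. -/
def IsKCover {n m : ℕ} (k : ℕ) (A : Fin m → NESubset n) (S : NESubset n) : Prop :=
  (∀ i, (A i).1 ⊆ S.1) ∧
    ∀ e ∈ S.1, (Finset.univ.filter (fun i => e ∈ (A i).1)).card = k

/-- The cone `BT_n` cut out by all Bollobás–Thomason uniform-cover inequalities. -/
def coneBT (n : ℕ) : Set (NESubset n → ℝ) :=
  {π | ∀ (m k : ℕ) (A : Fin m → NESubset n) (S : NESubset n), IsKCover k A S →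
    (k : ℝ) * π S ≤ ∑ i, π (A i)}

/-- The family `A` covers the family `B` (a subset may occur several times in either):
each element lies in equally many members of `A` and of `B`, and there is a bijection from the
pairs `(i, t)` with `t ∈ A i` to the pairs `(j, s)` with `s ∈ B j` which preserves the element and
sends `(i, t)` to some `(j, t)` with `A i ⊆ B j`. -/
def Covers {n k m : ℕ} (A : Fin k → NESubset n) (B : Fin m → NESubset n) : Prop :=
  (∀ e : Fin n, (Finset.univ.filter (fun i => e ∈ (A i).1)).card =
      (Finset.univ.filter (fun j => e ∈ (B j).1)).card) ∧
    ∃ f : (Σ i : Fin k, {t : Fin n // t ∈ (A i).1}) ≃ (Σ j : Fin m, {s : Fin n // s ∈ (B j).1}),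
      ∀ p, ((f p).2 : Fin n) = (p.2 : Fin n) ∧ (A p.1).1 ⊆ (B (f p).1).1

/-- The cone `NC_n` cut out by all nonuniform-cover inequalities. -/
def coneNC (n : ℕ) : Set (NESubset n → ℝ) :=
  {π | ∀ (k m : ℕ) (A : Fin k → NESubset n) (B : Fin m → NESubset n), Covers A B →
    ∑ j, π (B j) ≤ ∑ i, π (A i)}

/-- The coefficient vectors `c` of the Bollobás–Thomason inequalities, each written in the form
`0 ≤ ∑ S, c S * π S`. -/
def coeffsBT (n : ℕ) : Set (NESubset n → ℝ) :=
  {c | ∃ (m k : ℕ) (A : Fin m → NESubset n) (S : NESubset n), IsKCover k A S ∧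
    c = (∑ i, Pi.single (A i) (1 : ℝ)) - (k : ℝ) • Pi.single S (1 : ℝ)}

/-- The coefficient vectors `c` of the nonuniform-cover inequalities, each written in the form
`0 ≤ ∑ S, c S * π S`. -/
def coeffsNC (n : ℕ) : Set (NESubset n → ℝ) :=
  {c | ∃ (k m : ℕ) (A : Fin k → NESubset n) (B : Fin m → NESubset n), Covers A B ∧
    c = (∑ i, Pi.single (A i) (1 : ℝ)) - ∑ j, Pi.single (B j) (1 : ℝ)}

/-! Everything passes through one auxiliary set, `decomposableRegion`: the vectors π with π_S =
∑_{i∈S} z_S(i) and z_S(i) decreasing as S grows. It is visibly convex. In every dimension it lies in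
NC_n, since a cover compares the summands z one by one, and in Ψ_n, since the boxes with log-sides
z_S can be glued into one object. Also in every dimension NC_n ⊆ BT_n (a k-cover of S covers k
copies of S) and Ψ_n ⊆ BT_n (Finner's inequality applied to indicators of projections). So the
equalities and convexity reduce to BT_n ⊆ `decomposableRegion`, the only inclusion that needs n ≤ 3.
There z is found by elimination: `exists_log_box` supplies z for the full set, and `exists_split`
then interpolates z on each pair between the full set and the singletons. For the conic statement,
testing an NC coefficient vector c on simple decomposable vectors gives linear constraints on c.
These suffice to write down explicit weights on the BT inequalities, by `exists_dual_weights` when n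
= 3. -/

open MeasureTheory

/-! ### Decomposable vectors, convexity and cover inequalities. -/

/-- The vectors that split as `π S = ∑ i ∈ S, z S i` with `z S i` antitone in `S`. -/
def decomposableRegion (n : ℕ) : Set (NESubset n → ℝ) :=
  {π | ∃ z : NESubset n → Fin n → ℝ, (∀ S, π S = ∑ i ∈ S.1, z S i) ∧
    ∀ S S' : NESubset n, S.1 ⊆ S'.1 → ∀ i ∈ S.1, z S' i ≤ z S i}

theorem convex_decomposableRegion (n : ℕ) : Convex ℝ (decomposableRegion n) := by
  rintro π ⟨z, hz, hz'⟩ ρ ⟨w, hw, hw'⟩ a b ha hb _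
  refine ⟨a • z + b • w, fun S => ?_, fun S S' h i hi => ?_⟩
  · simp [hz, hw, Finset.sum_add_distrib, Finset.mul_sum]
  · have h1 := mul_le_mul_of_nonneg_left (hz' S S' h i hi) ha
    have h2 := mul_le_mul_of_nonneg_left (hw' S S' h i hi) hb
    simpa using add_le_add h1 h2

/-- Each side is a sum of z over pairs (set, element). The bijection of the cover matches pairs with
the same element and nested sets, so antitonicity compares the sums term by term. -/
theorem sum_le_sum_of_covers {n k m : ℕ} {π : NESubset n → ℝ} (hπ : π ∈ decomposableRegion n)
    {A : Fin k → NESubset n} {B : Fin m → NESubset n} (h : Covers A B) :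
    ∑ j, π (B j) ≤ ∑ i, π (A i) := by
  obtain ⟨z, hz, hz'⟩ := hπ
  obtain ⟨-, f, hf⟩ := h
  have key : ∀ {l : ℕ} (C : Fin l → NESubset n), ∑ i, π (C i) =
      ∑ p : (Σ i : Fin l, {t : Fin n // t ∈ (C i).1}), z (C p.1) p.2 := by
    intro l C
    rw [Fintype.sum_sigma]
    refine Finset.sum_congr rfl fun i _ => ?_
    rw [hz]
    exact (Finset.sum_coe_sort (C i).1 (fun t => z (C i) t)).symm
  rw [key, key, ← f.sum_comp]
  refine Finset.sum_le_sum fun p _ => ?_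
  rw [(hf p).1]
  exact hz' _ _ (hf p).2 _ p.2.2

theorem decomposableRegion_subset_coneNC (n : ℕ) : decomposableRegion n ⊆ coneNC n :=
  fun _ hπ _ _ _ _ h => sum_le_sum_of_covers hπ h

/-- Once the pairs are regrouped by element, each e has equally many pairs on both sides, so any
fibrewise bijection works: the required inclusions are all A_i ⊆ S. -/
theorem IsKCover.covers_const {n m k : ℕ} {A : Fin m → NESubset n} {S : NESubset n}
    (h : IsKCover k A S) : Covers A (fun _ : Fin k => S) := by
  have hcard : ∀ e : Fin n, (Finset.univ.filter (fun i => e ∈ (A i).1)).card =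
      (Finset.univ.filter (fun _ : Fin k => e ∈ S.1)).card := by
    intro e
    by_cases he : e ∈ S.1
    · simp [he, h.2 e he]
    · have : ∀ i, e ∉ (A i).1 := fun i hi => he (h.1 i hi)
      simp [he, this]
  refine ⟨hcard, ?_⟩
  have swap : ∀ {l : ℕ} (C : Fin l → NESubset n),
      Nonempty {F : (Σ i : Fin l, {t : Fin n // t ∈ (C i).1}) ≃
        (Σ e : Fin n, {i : Fin l // e ∈ (C i).1}) // ∀ p, (F p).1 = p.2} := fun C =>
    ⟨⟨⟨fun p => ⟨p.2, p.1, p.2.2⟩, fun p => ⟨p.2, p.1, p.2.2⟩, fun _ => rfl, fun _ => rfl⟩,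
      fun _ => rfl⟩⟩
  obtain ⟨F, hF⟩ := swap A
  obtain ⟨G, hG⟩ := swap (fun _ : Fin k => S)
  have e : ∀ e : Fin n, {i : Fin m // e ∈ (A i).1} ≃ {_i : Fin k // e ∈ S.1} := fun e =>
    Fintype.equivOfCardEq (by simpa [Fintype.card_subtype] using hcard e)
  refine ⟨(F.trans (Equiv.sigmaCongrRight e)).trans G.symm, fun p => ⟨?_, h.1 _⟩⟩
  rw [← hG, ← hF p]
  simp

theorem coneNC_subset_coneBT (n : ℕ) : coneNC n ⊆ coneBT n := by
  intro π hπ m k A S h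
  simpa using hπ m k A _ h.covers_const

/-! ### Realizing decomposable vectors by unions of boxes. -/

theorem logProjVector_eq_coe_iff {n : ℕ} {T : Set (Fin n → ℝ)} {S : NESubset n} {r : ℝ} :
    logProjVector T S = (r : EReal) ↔
      volume (coordProj S.1 T) = ENNReal.ofReal (Real.exp r) := by
  rw [← ENNReal.log_eq_iff, ENNReal.log_ofReal_of_pos (Real.exp_pos r), Real.log_exp]
  rfl

/-- The object is the union over S of the box with sides exp z_S(i), i ∈ S, in the coordinate
subspace of S. Projected to S, the box of S has volume exp π_S; boxes of larger sets land inside it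
by antitonicity, and every other box lands in a coordinate hyperplane, which is null. -/
theorem decomposableRegion_subset_constructibleRegion (n : ℕ) :
    decomposableRegion n ⊆ constructibleRegion n := by
  rintro π ⟨z, hz, hz'⟩
  set u : NESubset n → Fin n → ℝ := fun S i => if i ∈ S.1 then Real.exp (z S i) else 0 with hu
  have hu0 : ∀ S i, 0 ≤ u S i := fun S i => by
    simp only [hu]; split_ifs <;> positivity
  refine ⟨⋃ S, Set.Icc 0 (u S), ⟨isCompact_iUnion fun S => isCompact_Icc, ?_⟩, fun S => ?_⟩
  · intro x hx
    obtain ⟨S, hS⟩ := Set.mem_iUnion.1 hx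
    exact hS.1
  rw [logProjVector_eq_coe_iff]
  set Q : Set (S.1 → ℝ) := Set.Icc 0 (fun i => u S i) with hQ
  have hvol : volume Q = ENNReal.ofReal (Real.exp (π S)) := by
    rw [hQ, Real.volume_Icc_pi, ← ENNReal.ofReal_prod_of_nonneg (fun i _ => by simpa using hu0 S i),
      hz, Real.exp_sum, ← Finset.prod_coe_sort S.1]
    simp [hu]
  rw [← hvol]
  refine le_antisymm ?_ (measure_mono ?_)
  · have hnull : volume (⋃ i : S.1, {y : S.1 → ℝ | y i = 0}) = 0 :=
      measure_iUnion_null fun i => Measure.pi_hyperplane _ i 0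
    refine (measure_mono ?_).trans ((measure_union_le Q _).trans (by rw [hnull, add_zero]))
    rintro _ ⟨x, hx, rfl⟩
    obtain ⟨S', hx0, hx1⟩ := Set.mem_iUnion.1 hx
    by_cases hS : S.1 ⊆ S'.1
    · refine Or.inl ⟨fun i => hx0 i, fun i => (hx1 i).trans ?_⟩
      simpa [hu, hS i.2] using hz' S S' hS i i.2
    · obtain ⟨i, hi, hi'⟩ := Finset.not_subset.1 hS
      refine Or.inr (Set.mem_iUnion.2 ⟨⟨i, hi⟩, le_antisymm ?_ (hx0 i)⟩)
      simpa [hu, hi'] using hx1 i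
  · rintro y ⟨hy0, hy1⟩
    refine ⟨fun i => if h : i ∈ S.1 then y ⟨i, h⟩ else 0,
      Set.mem_iUnion.2 ⟨S, fun i => ?_, fun i => ?_⟩, by ext i; simp⟩
    · by_cases h : i ∈ S.1
      · simpa [h] using hy0 ⟨i, h⟩
      · simp [h]
    · by_cases h : i ∈ S.1
      · simpa [h] using hy1 ⟨i, h⟩
      · simp [h, hu]

/-! ### Finner's inequality and the BT inequalities for projections. -/

/-- The generalized Hölder (Finner) inequality for a uniform cover. -/
theorem lmarginal_prod_rpow_le {n m : ℕ} (k : ℕ) (hk : k ≠ 0) (A : Fin m → Finset (Fin n))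
    (f : Fin m → (Fin n → ℝ) → ENNReal) (hf : ∀ j, Measurable (f j))
    (hdep : ∀ j, DependsOn (f j) (A j : Set (Fin n))) (S : Finset (Fin n))
    (hS : ∀ e ∈ S, (Finset.univ.filter (fun j => e ∈ A j)).card = k) (x : Fin n → ℝ) :
    lmarginal (fun _ => volume) S (fun y => ∏ j, f j y ^ (1 / k : ℝ)) x ≤
      ∏ j, lmarginal (fun _ => volume) (S ∩ A j) (f j) x ^ (1 / k : ℝ) := by
  classical
  induction S using Finset.induction_on generalizing x with
  | empty => simp
  | insert i s hi ih =>
    have ih' := ih fun e he => hS e (Finset.mem_insert_of_mem he)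
    rw [lmarginal_insert _ (by fun_prop) hi]
    set G : Fin m → (Fin n → ℝ) → ENNReal :=
      fun j => lmarginal (fun _ => volume) (s ∩ A j) (f j) with hG
    have hGm : ∀ j, Measurable (G j) := fun j => (hf j).lmarginal _
    have hGm' : ∀ j, Measurable fun t => G j (Function.update x i t) :=
      fun j => (hGm j).comp (measurable_update x)
    have hconst : ∀ j, i ∉ A j → ∀ t, G j (Function.update x i t) = G j x := by
      intro j hj t
      refine lintegral_congr fun y => hdep j fun e he => ?_
      have hei : e ≠ i := fun h => hj (h ▸ he)
      simp [Function.updateFinset, hei]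
    have hk' : (k : ℝ) ≠ 0 := by exact_mod_cast hk
    set J := Finset.univ.filter (fun j => i ∈ A j) with hJ
    have hsplit : ∀ t, ∏ j, G j (Function.update x i t) ^ (1 / k : ℝ) =
        (∏ j ∈ J, G j (Function.update x i t) ^ (1 / k : ℝ)) *
          ∏ j ∈ Finset.univ.filter (fun j => i ∉ A j), G j x ^ (1 / k : ℝ) := by
      intro t
      rw [← Finset.prod_filter_mul_prod_filter_not Finset.univ (fun j => i ∈ A j)]
      congr 1
      exact Finset.prod_congr rfl fun j hj => by rw [hconst j (Finset.mem_filter.1 hj).2]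
    -- Integrate the coordinates of s first, by induction, and i last. Factors with i ∉ A j do not
    -- depend on t and come out; exactly k factors remain, so Hölder applies with exponents 1/k
    -- summing to 1.
    calc _ ≤ ∫⁻ t, ∏ j, G j (Function.update x i t) ^ (1 / k : ℝ) :=
          lintegral_mono fun t => ih' _
      _ = (∫⁻ t, ∏ j ∈ J, G j (Function.update x i t) ^ (1 / k : ℝ)) *
          ∏ j ∈ Finset.univ.filter (fun j => i ∉ A j), G j x ^ (1 / k : ℝ) := by
        simp_rw [hsplit]
        exact lintegral_mul_const _ (Finset.measurable_prod _ fun j _ => (hGm' j).pow_const _)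
      _ ≤ (∏ j ∈ J, (∫⁻ t, G j (Function.update x i t)) ^ (1 / k : ℝ)) *
          ∏ j ∈ Finset.univ.filter (fun j => i ∉ A j), G j x ^ (1 / k : ℝ) := by
        gcongr
        refine ENNReal.lintegral_prod_norm_pow_le J (fun j _ => (hGm' j).aemeasurable) ?_
          fun _ _ => by positivity
        rw [Finset.sum_const, hS i (Finset.mem_insert_self _ _), nsmul_eq_mul,
          mul_one_div_cancel hk']
      _ = _ := by
        rw [← Finset.prod_filter_mul_prod_filter_not Finset.univ (fun j => i ∈ A j)]
        congr 1
        · refine Finset.prod_congr rfl fun j hj => ?_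
          rw [Finset.insert_inter_of_mem (Finset.mem_filter.1 hj).2,
            lmarginal_insert _ (hf j) fun h => hi (Finset.mem_inter.1 h).1]
        · refine Finset.prod_congr rfl fun j hj => ?_
          rw [Finset.insert_inter_of_notMem (Finset.mem_filter.1 hj).2]

/-- A point of T_S restricts to a point of each T_{A_j}, so the indicator of T_S is at most the
product of those of the T_{A_j}. Finner's inequality integrates this bound; indicators are unchanged
by the power 1/k. -/
theorem volume_coordProj_le {n m k : ℕ} (hk : k ≠ 0) {A : Fin m → NESubset n} {S : NESubset n}
    (h : IsKCover k A S) {T : Set (Fin n → ℝ)} (hT : IsCompact T) :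
    volume (coordProj S.1 T) ≤ ∏ j, volume (coordProj (A j).1 T) ^ (1 / k : ℝ) := by
  classical
  have hmeas : ∀ R : Finset (Fin n), MeasurableSet (coordProj R T) := fun R =>
    (hT.image (by fun_prop)).measurableSet
  set g : Finset (Fin n) → (Fin n → ℝ) → ENNReal := fun R =>
    fun x => (coordProj R T).indicator 1 (fun i : R => x i) with hg
  have hgm : ∀ R, Measurable (g R) := fun R =>
    (measurable_one.indicator (hmeas R)).comp (by fun_prop)
  have hmarg : ∀ R, lmarginal (fun _ => volume) R (g R) 0 = volume (coordProj R T) := by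
    intro R
    rw [← lintegral_indicator_one (hmeas R)]
    refine lintegral_congr fun y => ?_
    simp [hg, Function.updateFinset]
  have key := lmarginal_prod_rpow_le k hk (fun j => (A j).1) (fun j => g (A j).1)
    (fun j => hgm _) (fun j x y hxy => by
      simp only [hg]
      congr 1
      ext i
      exact hxy i i.2) S.1 h.2 0
  simp only [Finset.inter_eq_right.2 (h.1 _), hmarg] at key
  refine le_trans ?_ key
  rw [← hmarg]
  refine lmarginal_mono (fun x => ?_) 0
  by_cases hx : (fun i : S.1 => x i) ∈ coordProj S.1 T
  · have h1 : ∀ j, g (A j).1 x = 1 := by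
      intro j
      obtain ⟨y, hy, hyx⟩ := hx
      have hm : (fun i : (A j).1 => x i) ∈ coordProj (A j).1 T :=
        ⟨y, hy, funext fun i => congrFun hyx ⟨i, h.1 j i.2⟩⟩
      simp [hg, hm]
    simp only [h1]
    simp [hg, hx]
  · simp [hg, hx]

theorem constructibleRegion_subset_coneBT (n : ℕ) : constructibleRegion n ⊆ coneBT n := by
  rintro π ⟨T, ⟨hT, -⟩, hπ⟩ m k A S h
  simp only [logProjVector_eq_coe_iff] at hπ
  -- A 0-cover by nonempty sets has no members, so its inequality is 0 ≤ 0.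
  rcases eq_or_ne k 0 with rfl | hk
  · obtain rfl : m = 0 := by
      by_contra hm
      obtain ⟨e, he⟩ := (A ⟨0, Nat.pos_of_ne_zero hm⟩).2
      have := h.2 e (h.1 _ he)
      rw [Finset.card_eq_zero, Finset.filter_eq_empty_iff] at this
      exact this (Finset.mem_univ _) he
    simp
  have key := volume_coordProj_le hk h hT
  simp only [hπ] at key
  simp only [ENNReal.ofReal_rpow_of_pos (Real.exp_pos _), ← Real.exp_mul] at key
  rw [← ENNReal.ofReal_prod_of_nonneg (fun _ _ => (Real.exp_pos _).le), ← Real.exp_sum,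
    ENNReal.ofReal_le_ofReal_iff (Real.exp_pos _).le, Real.exp_le_exp, ← Finset.sum_mul,
    mul_one_div, le_div_iff₀ (by positivity)] at key
  linarith

/-! ### BT vectors are decomposable for n ≤ 3. -/

theorem NESubset.cases_two (S : NESubset 2) :
    S = ⟨{0}, by decide⟩ ∨ S = ⟨{1}, by decide⟩ ∨ S = ⟨{0, 1}, by decide⟩ := by
  revert S; decide

theorem NESubset.cases_three (S : NESubset 3) :
    S = ⟨{0}, by decide⟩ ∨ S = ⟨{1}, by decide⟩ ∨ S = ⟨{2}, by decide⟩ ∨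
      S = ⟨{0, 1}, by decide⟩ ∨ S = ⟨{0, 2}, by decide⟩ ∨ S = ⟨{1, 2}, by decide⟩ ∨
      S = ⟨{0, 1, 2}, by decide⟩ := by
  revert S; decide

theorem NESubset.sum_two (g : NESubset 2 → ℝ) :
    ∑ S, g S = g ⟨{0}, by decide⟩ + g ⟨{1}, by decide⟩ + g ⟨{0, 1}, by decide⟩ := by
  rw [show (Finset.univ : Finset (NESubset 2)) =
    {⟨{0}, by decide⟩, ⟨{1}, by decide⟩, ⟨{0, 1}, by decide⟩} by decide,
    Finset.sum_insert (by decide), Finset.sum_insert (by decide), Finset.sum_singleton]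
  ring

theorem NESubset.sum_three (g : NESubset 3 → ℝ) :
    ∑ S, g S = g ⟨{0}, by decide⟩ + g ⟨{1}, by decide⟩ + g ⟨{2}, by decide⟩ +
      g ⟨{0, 1}, by decide⟩ + g ⟨{0, 2}, by decide⟩ + g ⟨{1, 2}, by decide⟩ +
      g ⟨{0, 1, 2}, by decide⟩ := by
  rw [show (Finset.univ : Finset (NESubset 3)) =
    {⟨{0}, by decide⟩, ⟨{1}, by decide⟩, ⟨{2}, by decide⟩, ⟨{0, 1}, by decide⟩,
      ⟨{0, 2}, by decide⟩, ⟨{1, 2}, by decide⟩, ⟨{0, 1, 2}, by decide⟩} by decide,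
    Finset.sum_insert (by decide), Finset.sum_insert (by decide), Finset.sum_insert (by decide),
    Finset.sum_insert (by decide), Finset.sum_insert (by decide), Finset.sum_insert (by decide),
    Finset.sum_singleton]
  ring

instance {n m : ℕ} (k : ℕ) (A : Fin m → NESubset n) (S : NESubset n) :
    Decidable (IsKCover k A S) := by
  unfold IsKCover; infer_instance

theorem coneBT_zero_subset : coneBT 0 ⊆ decomposableRegion 0 := fun _ _ =>
  ⟨0, fun S => S.2.elim fun i => i.elim0, fun _ _ _ i => i.elim0⟩

theorem coneBT_one_subset : coneBT 1 ⊆ decomposableRegion 1 := by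
  intro π _
  have hS : ∀ S : NESubset 1, S = ⟨{0}, by decide⟩ := by decide
  refine ⟨fun S _ => π S, fun S => ?_, fun S S' _ _ _ => ?_⟩
  · rw [hS S]; simp
  · rw [hS S, hS S']

theorem coneBT_two_subset : coneBT 2 ⊆ decomposableRegion 2 := by
  intro π hπ
  have h := hπ 2 1 ![⟨{0}, by decide⟩, ⟨{1}, by decide⟩] ⟨{0, 1}, by decide⟩ (by decide)
  simp [Fin.sum_univ_succ] at h
  refine ⟨fun S => if S.1 = {0, 1} then
    ![π ⟨{0}, by decide⟩, π ⟨{0, 1}, by decide⟩ - π ⟨{0}, by decide⟩] else fun _ => π S,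
    fun S => ?_, fun S S' hSS => ?_⟩
  · rcases S.cases_two with rfl | rfl | rfl <;>
      simp +decide
  · rcases S.cases_two with rfl | rfl | rfl <;> rcases S'.cases_two with rfl | rfl | rfl <;>
      first
      | exact absurd hSS (by decide)
      | (simp +decide; linarith)
      | simp +decide

/-- Splitting `a ≤ l₁ + l₂` within given lower bounds. -/
theorem exists_split {a l₁ l₂ x₁ x₂ : ℝ} (h : a ≤ l₁ + l₂) (h₁ : x₁ ≤ l₁) (h₂ : x₂ ≤ l₂)
    (hx : x₁ + x₂ ≤ a) : ∃ y, x₁ ≤ y ∧ y ≤ l₁ ∧ x₂ ≤ a - y ∧ a - y ≤ l₂ := by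
  refine ⟨max x₁ (a - l₂), le_max_left _ _, max_le h₁ (by linarith), ?_, ?_⟩
  · have : max x₁ (a - l₂) ≤ a - x₂ := max_le (by linarith) (by linarith)
    linarith
  · linarith [le_max_right x₁ (a - l₂)]

/-- The box theorem in dimension three, in logarithmic form. -/
theorem exists_log_box {l₀ l₁ l₂ a₀₁ a₀₂ a₁₂ v : ℝ} (h₀ : v ≤ l₀ + a₁₂) (h₁ : v ≤ l₁ + a₀₂)
    (h₂ : v ≤ l₂ + a₀₁) (h₁₂ : a₁₂ ≤ l₁ + l₂) (hv : 2 * v ≤ a₀₁ + a₀₂ + a₁₂) :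
    ∃ x₀ x₁ x₂, x₀ + x₁ + x₂ = v ∧ x₀ ≤ l₀ ∧ x₁ ≤ l₁ ∧ x₂ ≤ l₂ ∧
      x₀ + x₁ ≤ a₀₁ ∧ x₀ + x₂ ≤ a₀₂ ∧ x₁ + x₂ ≤ a₁₂ := by
  -- Given x₀ + x₁ + x₂ = v, each upper bound on a pair is a lower bound on the third variable: x₀ ≥
  -- v - a₁₂, x₁ ≥ v - a₀₂, x₂ ≥ v - a₀₁. So split v into x₀ and the rest, whose bounds are the sums
  -- of those for x₁ and x₂, then split the rest.
  obtain ⟨x₀, hx₀, hx₀', hx₁, hx₁'⟩ := exists_split (a := v) (l₁ := l₀) (l₂ := l₁ + l₂)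
    (x₁ := v - a₁₂) (x₂ := (v - a₀₂) + (v - a₀₁))
    (by linarith) (by linarith) (by linarith) (by linarith)
  obtain ⟨x₁, h3, h4, h5, h6⟩ := exists_split (a := v - x₀) hx₁'
    (show v - a₀₂ ≤ l₁ by linarith) (show v - a₀₁ ≤ l₂ by linarith) hx₁
  exact ⟨x₀, x₁, v - x₀ - x₁, by ring, by linarith, by linarith, by linarith, by linarith,
    by linarith, by linarith⟩

theorem coneBT_three_subset : coneBT 3 ⊆ decomposableRegion 3 := by
  intro π hπ
  have h01 := hπ 2 1 ![⟨{0}, by decide⟩, ⟨{1}, by decide⟩] ⟨{0, 1}, by decide⟩ (by decide)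
  have h02 := hπ 2 1 ![⟨{0}, by decide⟩, ⟨{2}, by decide⟩] ⟨{0, 2}, by decide⟩ (by decide)
  have h12 := hπ 2 1 ![⟨{1}, by decide⟩, ⟨{2}, by decide⟩] ⟨{1, 2}, by decide⟩ (by decide)
  have h0 := hπ 2 1 ![⟨{0}, by decide⟩, ⟨{1, 2}, by decide⟩] ⟨{0, 1, 2}, by decide⟩ (by decide)
  have h1 := hπ 2 1 ![⟨{1}, by decide⟩, ⟨{0, 2}, by decide⟩] ⟨{0, 1, 2}, by decide⟩ (by decide)
  have h2 := hπ 2 1 ![⟨{2}, by decide⟩, ⟨{0, 1}, by decide⟩] ⟨{0, 1, 2}, by decide⟩ (by decide)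
  have hv := hπ 3 2 ![⟨{0, 1}, by decide⟩, ⟨{0, 2}, by decide⟩, ⟨{1, 2}, by decide⟩]
    ⟨{0, 1, 2}, by decide⟩ (by decide)
  simp only [Fin.sum_univ_two, Fin.sum_univ_three, Matrix.cons_val, Nat.cast_one, one_mul,
    Nat.cast_ofNat] at h01 h02 h12 h0 h1 h2 hv
  obtain ⟨x₀, x₁, x₂, hx, e0, e1, e2, e01, e02, e12⟩ := exists_log_box h0 h1 h2 h12 hv
  -- Each pair's value is split between the box sides x of the full set (below) and the singleton
  -- values (above), as antitonicity requires.
  obtain ⟨p, p1, p2, p3, p4⟩ := exists_split h01 e0 e1 e01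
  obtain ⟨q, q1, q2, q3, q4⟩ := exists_split h02 e0 e2 e02
  obtain ⟨r, r1, r2, r3, r4⟩ := exists_split h12 e1 e2 e12
  -- The zeros sit at coordinates outside S and play no role.
  refine ⟨fun S => if S.1 = {0, 1, 2} then ![x₀, x₁, x₂]
    else if S.1 = {0, 1} then ![p, π ⟨{0, 1}, by decide⟩ - p, 0]
    else if S.1 = {0, 2} then ![q, 0, π ⟨{0, 2}, by decide⟩ - q]
    else if S.1 = {1, 2} then ![0, r, π ⟨{1, 2}, by decide⟩ - r] else fun _ => π S,
    fun S => ?_, fun S S' hSS => ?_⟩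
  · rcases S.cases_three with rfl | rfl | rfl | rfl | rfl | rfl | rfl <;>
      simp +decide [← hx, add_assoc]
  · rcases S.cases_three with rfl | rfl | rfl | rfl | rfl | rfl | rfl <;>
      rcases S'.cases_three with rfl | rfl | rfl | rfl | rfl | rfl | rfl <;>
      first
      | exact absurd hSS (by decide)
      | simp +decide [*]

theorem coneBT_subset_decomposableRegion {n : ℕ} (hn : n ≤ 3) :
    coneBT n ⊆ decomposableRegion n := by
  interval_cases n
  exacts [coneBT_zero_subset, coneBT_one_subset, coneBT_two_subset, coneBT_three_subset]

/-! ### NC inequalities as conic combinations of BT inequalities. -/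

theorem sum_mul_nonneg_of_mem_coeffsNC {n : ℕ} {c : NESubset n → ℝ} (hc : c ∈ coeffsNC n)
    {π : NESubset n → ℝ} (hπ : π ∈ decomposableRegion n) : 0 ≤ ∑ S, c S * π S := by
  obtain ⟨k, m, A, B, h, rfl⟩ := hc
  have key : ∀ {l : ℕ} (C : Fin l → NESubset n),
      ∑ S, (∑ i, Pi.single (C i) (1 : ℝ) : NESubset n → ℝ) S * π S = ∑ i, π (C i) := by
    intro l C
    simp only [Finset.sum_apply, Finset.sum_mul]
    rw [Finset.sum_comm]
    simp [Pi.single_apply]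
  simp only [Pi.sub_apply, sub_mul, Finset.sum_sub_distrib, key, sub_nonneg]
  exact sum_le_sum_of_covers hπ h

/-- Each element is covered equally often on both sides of a nonuniform-cover inequality. -/
theorem sum_eq_zero_of_mem_coeffsNC {n : ℕ} {c : NESubset n → ℝ} (hc : c ∈ coeffsNC n)
    (i : Fin n) : ∑ S, (if i ∈ S.1 then c S else 0) = 0 := by
  -- The test vector has z independent of S, hence antitone for either sign of a; a = 1 and a = -1
  -- give the two inequalities.
  have key : ∀ a : ℝ, 0 ≤ ∑ S, c S * ∑ j ∈ S.1, if j = i then a else 0 := fun a =>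
    sum_mul_nonneg_of_mem_coeffsNC hc
      ⟨fun _ j => if j = i then a else 0, fun _ => rfl, fun _ _ _ _ _ => le_rfl⟩
  have h1 := key 1
  have h2 := key (-1)
  simp only [Finset.sum_ite_eq', mul_ite, mul_one, mul_zero, mul_neg] at h1 h2
  have : ∀ S : NESubset n, (if i ∈ S.1 then -c S else 0) = -(if i ∈ S.1 then c S else 0) :=
    fun S => by split_ifs <;> simp
  simp only [this, Finset.sum_neg_distrib] at h2
  linarith

/-- The coefficients of a nonuniform-cover inequality sum to at most zero over the members of an
upper set that contain a given element. -/
theorem sum_upperSet_nonpos_of_mem_coeffsNC {n : ℕ} {c : NESubset n → ℝ} (hc : c ∈ coeffsNC n)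
    (i : Fin n) (U : Finset (NESubset n)) (hU : ∀ S ∈ U, ∀ S', S.1 ⊆ S'.1 → S' ∈ U) :
    ∑ S, (if S ∈ U ∧ i ∈ S.1 then c S else 0) ≤ 0 := by
  -- The test function z drops from 0 to -1 at coordinate i on entering U; it is antitone because U
  -- is an upper set.
  have key : 0 ≤ ∑ S, c S * ∑ j ∈ S.1, if j = i then (if S ∈ U then (-1 : ℝ) else 0) else 0 :=
    sum_mul_nonneg_of_mem_coeffsNC hc
      ⟨fun S j => if j = i then (if S ∈ U then (-1 : ℝ) else 0) else 0, fun _ => rfl,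
        fun S S' h j _ => by
          by_cases hS : S ∈ U
          · simp [hS, hU S hS S' h]
          · simp only [hS, if_false, ite_self]
            split_ifs <;> norm_num⟩
  have : ∀ S : NESubset n,
      c S * (∑ j ∈ S.1, if j = i then (if S ∈ U then (-1 : ℝ) else 0) else 0) =
        -(if S ∈ U ∧ i ∈ S.1 then c S else 0) := fun S => by
    rw [Finset.sum_ite_eq']
    by_cases h1 : S ∈ U <;> by_cases h2 : i ∈ S.1 <;> simp [h1, h2]
  simp only [this, Finset.sum_neg_distrib] at key
  linarith

/-- The coefficient vector of the inequality `k * π S ≤ ∑ i, π (A i)`. -/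
noncomputable def coeffVector {n m : ℕ} (k : ℕ) (A : Fin m → NESubset n) (S : NESubset n) :
    NESubset n → ℝ :=
  (∑ i, Pi.single (A i) (1 : ℝ)) - (k : ℝ) • Pi.single S (1 : ℝ)

theorem coeffVector_apply {n m : ℕ} (k : ℕ) (A : Fin m → NESubset n) (S R : NESubset n) :
    coeffVector k A S R = (∑ i, if R = A i then (1 : ℝ) else 0) - if R = S then (k : ℝ) else 0 := by
  simp [coeffVector, Pi.single_apply]

theorem IsKCover.coeffVector_mem {n m k : ℕ} {A : Fin m → NESubset n} {S : NESubset n}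
    (h : IsKCover k A S) : coeffVector k A S ∈ coeffsBT n :=
  ⟨m, k, A, S, h, rfl⟩

theorem exists_conic_two {c : NESubset 2 → ℝ} (hc : c ∈ coeffsNC 2) :
    ∃ (N : ℕ) (w : Fin N → ℝ) (b : Fin N → (NESubset 2 → ℝ)),
      (∀ r, 0 ≤ w r) ∧ (∀ r, b r ∈ coeffsBT 2) ∧ c = ∑ r, w r • b r := by
  have h0 := sum_eq_zero_of_mem_coeffsNC hc 0
  have h1 := sum_eq_zero_of_mem_coeffsNC hc 1
  have h2 := sum_upperSet_nonpos_of_mem_coeffsNC hc 0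
    (Finset.univ.filter fun S => {0, 1} ⊆ S.1) (by decide)
  simp +decide [NESubset.sum_two] at h0 h1 h2
  -- The coefficient of the pair fixes the weight; those of the singletons then agree by the balance
  -- equations `h0` and `h1`.
  refine ⟨1, fun _ => -c ⟨{0, 1}, by decide⟩,
    fun _ => coeffVector 1 ![⟨{0}, by decide⟩, ⟨{1}, by decide⟩] ⟨{0, 1}, by decide⟩,
    fun _ => by simpa using h2, fun _ => IsKCover.coeffVector_mem (by decide), ?_⟩
  funext S
  rcases S.cases_two with rfl | rfl | rfl <;>
    simp only [Finset.univ_unique, Finset.sum_singleton, Pi.smul_apply, smul_eq_mul,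
      coeffVector_apply, Fin.sum_univ_two, Matrix.cons_val] <;>
    simp +decide <;> linarith

/-- Here p_i stands for the coefficient of the pair omitting i, and -C for that of the full set. The
weight d_i goes to "full set ≤ {i} + complementary pair" and η to "twice the full set ≤ the three
pairs". The last equation matches the full set, and the excess d_i + η - p_i ≥ 0 is left for
splitting that pair into singletons. -/
theorem exists_dual_weights {p₀ p₁ p₂ C : ℝ} (hC : 0 ≤ C) (h0 : p₀ ≤ C) (h1 : p₁ ≤ C) (h2 : p₂ ≤ C)
    (h01 : p₀ + p₁ ≤ C) (h02 : p₀ + p₂ ≤ C) (h12 : p₁ + p₂ ≤ C) :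
    ∃ η d₀ d₁ d₂ : ℝ, 0 ≤ η ∧ 0 ≤ d₀ ∧ 0 ≤ d₁ ∧ 0 ≤ d₂ ∧ p₀ ≤ d₀ + η ∧ p₁ ≤ d₁ + η ∧
      p₂ ≤ d₂ + η ∧ d₀ + d₁ + d₂ + 2 * η = C := by
  -- With this η at most two of the positive parts of p_i - η are nonzero, and their sum plus 2η is
  -- bounded by C through a single or pairwise hypothesis (or 0 ≤ C). So d₁, d₂ can be positive
  -- parts and d₀ absorbs the slack.
  set η := max 0 (min p₀ (min p₁ p₂)) with hη
  suffices h : max 0 (p₀ - η) ≤ C - 2 * η - max 0 (p₁ - η) - max 0 (p₂ - η) by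
    refine ⟨η, C - 2 * η - max 0 (p₁ - η) - max 0 (p₂ - η), max 0 (p₁ - η), max 0 (p₂ - η),
      le_max_left _ _, (le_max_left _ _).trans h, le_max_left _ _, le_max_left _ _, ?_, ?_, ?_,
      by ring⟩
    · linarith [(le_max_right 0 (p₀ - η)).trans h]
    · linarith [le_max_right 0 (p₁ - η)]
    · linarith [le_max_right 0 (p₂ - η)]
  grind

theorem exists_conic_three {c : NESubset 3 → ℝ} (hc : c ∈ coeffsNC 3) :
    ∃ (N : ℕ) (w : Fin N → ℝ) (b : Fin N → (NESubset 3 → ℝ)),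
      (∀ r, 0 ≤ w r) ∧ (∀ r, b r ∈ coeffsBT 3) ∧ c = ∑ r, w r • b r := by
  have e0 := sum_eq_zero_of_mem_coeffsNC hc 0
  have e1 := sum_eq_zero_of_mem_coeffsNC hc 1
  have e2 := sum_eq_zero_of_mem_coeffsNC hc 2
  have u := sum_upperSet_nonpos_of_mem_coeffsNC hc 0
    (Finset.univ.filter fun S => {0, 1, 2} ⊆ S.1) (by decide)
  have u01 := sum_upperSet_nonpos_of_mem_coeffsNC hc 0
    (Finset.univ.filter fun S => {0, 1} ⊆ S.1) (by decide)
  have u02 := sum_upperSet_nonpos_of_mem_coeffsNC hc 0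
    (Finset.univ.filter fun S => {0, 2} ⊆ S.1) (by decide)
  have u12 := sum_upperSet_nonpos_of_mem_coeffsNC hc 1
    (Finset.univ.filter fun S => {1, 2} ⊆ S.1) (by decide)
  have u0 := sum_upperSet_nonpos_of_mem_coeffsNC hc 0
    (Finset.univ.filter fun S => 2 ≤ S.1.card) (by decide)
  have u1 := sum_upperSet_nonpos_of_mem_coeffsNC hc 1
    (Finset.univ.filter fun S => 2 ≤ S.1.card) (by decide)
  have u2 := sum_upperSet_nonpos_of_mem_coeffsNC hc 2
    (Finset.univ.filter fun S => 2 ≤ S.1.card) (by decide)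
  simp +decide [NESubset.sum_three] at e0 e1 e2 u u01 u02 u12 u0 u1 u2
  obtain ⟨η, d₀, d₁, d₂, hη, hd₀, hd₁, hd₂, hp₀, hp₁, hp₂, hsum⟩ := exists_dual_weights
    (p₀ := c ⟨{1, 2}, by decide⟩) (p₁ := c ⟨{0, 2}, by decide⟩) (p₂ := c ⟨{0, 1}, by decide⟩)
    (C := -c ⟨{0, 1, 2}, by decide⟩) (by linarith) (by linarith) (by linarith) (by linarith)
    (by linarith) (by linarith) (by linarith)
  -- The first three weights are forced by the coefficients of the pairs; those of the singletons
  -- then follow from `e0`, `e1`, `e2` and `hsum`.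
  refine ⟨7, ![d₂ + η - c ⟨{0, 1}, by decide⟩, d₁ + η - c ⟨{0, 2}, by decide⟩,
      d₀ + η - c ⟨{1, 2}, by decide⟩, d₀, d₁, d₂, η],
    ![coeffVector 1 ![⟨{0}, by decide⟩, ⟨{1}, by decide⟩] ⟨{0, 1}, by decide⟩,
      coeffVector 1 ![⟨{0}, by decide⟩, ⟨{2}, by decide⟩] ⟨{0, 2}, by decide⟩,
      coeffVector 1 ![⟨{1}, by decide⟩, ⟨{2}, by decide⟩] ⟨{1, 2}, by decide⟩,
      coeffVector 1 ![⟨{0}, by decide⟩, ⟨{1, 2}, by decide⟩] ⟨{0, 1, 2}, by decide⟩,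
      coeffVector 1 ![⟨{1}, by decide⟩, ⟨{0, 2}, by decide⟩] ⟨{0, 1, 2}, by decide⟩,
      coeffVector 1 ![⟨{2}, by decide⟩, ⟨{0, 1}, by decide⟩] ⟨{0, 1, 2}, by decide⟩,
      coeffVector 2 ![⟨{0, 1}, by decide⟩, ⟨{0, 2}, by decide⟩, ⟨{1, 2}, by decide⟩]
        ⟨{0, 1, 2}, by decide⟩], ?_, ?_, ?_⟩
  · simp only [Fin.forall_fin_succ]
    simp [*]
  · simp only [Fin.forall_fin_succ]
    refine ⟨?_, ?_, ?_, ?_, ?_, ?_, ?_, fun i => i.elim0⟩ <;>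
      exact IsKCover.coeffVector_mem (by decide)
  · funext S
    rcases S.cases_three with rfl | rfl | rfl | rfl | rfl | rfl | rfl <;>
      simp only [Finset.sum_apply, Pi.smul_apply, smul_eq_mul, Fin.sum_univ_seven,
        Matrix.cons_val, coeffVector_apply, Fin.sum_univ_two, Fin.sum_univ_three] <;>
      simp +decide <;> linarith

theorem exists_conic_of_mem_coeffsNC {n : ℕ} (hn : n ≤ 3) {c : NESubset n → ℝ}
    (hc : c ∈ coeffsNC n) : ∃ (N : ℕ) (w : Fin N → ℝ) (b : Fin N → (NESubset n → ℝ)),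
      (∀ r, 0 ≤ w r) ∧ (∀ r, b r ∈ coeffsBT n) ∧ c = ∑ r, w r • b r := by
  interval_cases n
  · exact ⟨0, Fin.elim0, Fin.elim0, fun r => r.elim0, fun r => r.elim0,
      funext fun S => S.2.elim fun i => i.elim0⟩
  · refine ⟨0, Fin.elim0, Fin.elim0, fun r => r.elim0, fun r => r.elim0, funext fun S => ?_⟩
    have h := sum_eq_zero_of_mem_coeffsNC hc 0
    have hS : ∀ S : NESubset 1, S = ⟨{0}, by decide⟩ := by decide
    rw [Fintype.sum_eq_single S fun R hR => absurd ((hS R).trans (hS S).symm) hR,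
      if_pos (by rw [hS S]; decide)] at h
    simpa using h
  · exact exists_conic_two hc
  · exact exists_conic_three hc

theorem mainTheorem7 (n : ℕ) (hn : n ≤ 3) :
    coneBT n = coneNC n ∧ coneNC n = constructibleRegion n ∧
      (∀ c ∈ coeffsNC n, ∃ (N : ℕ) (w : Fin N → ℝ) (b : Fin N → (NESubset n → ℝ)),
        (∀ r, 0 ≤ w r) ∧ (∀ r, b r ∈ coeffsBT n) ∧ c = ∑ r, w r • b r) ∧
      Convex ℝ (constructibleRegion n) := by
  have hBT := coneBT_subset_decomposableRegion hn
  have hNC := (coneNC_subset_coneBT n).trans hBT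
  have hΨ := (constructibleRegion_subset_coneBT n).trans hBT
  have eΨ := hΨ.antisymm (decomposableRegion_subset_constructibleRegion n)
  refine ⟨(hBT.trans (decomposableRegion_subset_coneNC n)).antisymm (coneNC_subset_coneBT n),
    (hNC.antisymm (decomposableRegion_subset_coneNC n)).trans eΨ.symm,
    fun c hc => exists_conic_of_mem_coeffsNC hn hc, ?_⟩
  rw [eΨ]
  exact convex_decomposableRegion n
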